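/- Let $\mu$ be the standard normal distribution on $\mathbb{R}$, and let $\mathcal{H}_k(x)=\frac{(-1)^k}{\sqrt{k!}}e^{x^2/2}\frac{d^k}{dx^k}e^{-x^2/2}$, $k\ge 0$, be the normalized Hermite polynomials. For $f\in L^2(\mu)$ write $f_k=\int f\mathcal{H}_k\,d\mu$ for its Hermite coefficients. For $a\in[0,1]$ and $\phi\in L^2(\mu)$ let $Q_{a,\phi}$ be the bounded operator on $L^2(\mu)$ given by $$Q_{a,\phi}[f](x)=\int f\bigl(ax+\sqrt{1-a^2}\,y\bigr)\phi(y)\,d\mu(y),$$ and let $Q^*_{a,\phi}$ be its adjoint in $L^2(\mu)$. Let $r\ge 1$ be an integer and $K=r+1$. Let $\phi$ be a polynomial which is a probability density with respect to $\mu$ ($\phi\ge 0$ on $\mathbb{R}$ and $\int\phi\,d\mu=1$), and which satisfies $\int x^k\phi(x)\,d\mu(x)=\int x^k\,d\mu(x)$ for $1\le k\le r$. Let $N$ be the degree of $\phi$. Then either $\phi=1$ and $N=0$, or $N\ge K$ and $\phi=1+\sum_{k=K}^N\phi_k\mathcal{H}_k$. Put $$\gamma_k=\frac{1}{\sqrt{k!}}\Bigl(1+\frac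 NK\Bigr)^{k/2}|\phi_k|,\qquad d_\phi(a)=\sum_{k=r+1}^N\frac{|\phi_k|}{\sqrt{k!}}\Bigl(-2(r+1+N)\Bigl(1+\frac{N}{r+1}\Bigr)\log a\Bigr)^{k/2}\quad(0<a<1),$$ $a_\phi=\bigl(1+\frac{N}{r+1}\bigr)^{-1/4}$ if $\phi\ne 1$, and $a_\phi=0$ if $\phi=1$. Assume that $\phi$ satisfies the following hypothesis **(H)**, in which $0^0=1$: * (H1) for all $k$ with $K\le k\le N-2$: $(k+2)\gamma_{k+2}\le\gamma_k$; * (H2a) if $K\le N-1$: $$\Bigl(\frac{2(K+1)\gamma_{K+1}}{N}\Bigr)^{N}(K-1)^{K-1}(N-K+1)^{N-K+1}\le(2\gamma_N)^{K-1}$$ and $$\Bigl(\frac{2K\gamma_K}{N-1}\Bigr)^{N-1}(K-2)^{K-2}(N-K+1)^{N-K+1}\le(2\gamma_{N-1})^{K-2};$$ * (H2b) if $K=N$: $\gamma_N\le\dfrac{1}{2(N-2)^{(N-2)/2}}$. Then for every $g\in L^2(\mu)$ with $g_k=0$ for all $k<r+1$, and every $a\in(a_\phi,1)$, $$\int\bigl(Q^*_{a,\phi}[g]\bigr)^2d\mu\le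 a^{r+1}\bigl(1+d_\phi(a)\bigr)^2\int g^2\,d\mu,$$ and, more precisely, $$\int\bigl(Q^*_{a,\phi}[g]\bigr)^2d\mu\le a^{2(r+1)}\bigl(1+d_\phi(a)\bigr)^2\int g^2\,d\mu.$$ -/

import Mathlib

open MeasureTheory ProbabilityTheory
open scoped NNReal ENNReal

noncomputable section

namespace BaryConv

/-- The standard normal distribution on the real line. -/
abbrev gauss : Measure ℝ := gaussianReal 0 1

/-- The real Hilbert space `L²(μ)`, where `μ` is the standard normal distribution. -/
abbrev L2 : Type := Lp ℝ 2 gauss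

/-! ### Hermite polynomials and coefficients -/

/-- The normalized (probabilists') Hermite polynomials, an orthonormal family in `L²(μ)`. -/
def hermiteFn (n : ℕ) (x : ℝ) : ℝ :=
  ((Polynomial.hermite n).map (Int.castRingHom ℝ)).eval x / √(n.factorial : ℝ)

/-- The Hermite coefficient of order `k` of a function on the line. -/
def hermiteCoeff (f : ℝ → ℝ) (k : ℕ) : ℝ := ∫ x, f x * hermiteFn k x ∂gauss

/-- The polynomial `φ` is a density with respect to `μ`. -/
structure IsDensity (φ : Polynomial ℝ) : Prop where
  nonneg : ∀ x : ℝ, 0 ≤ φ.eval x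
  integral_eq_one : ∫ x, φ.eval x ∂gauss = 1

/-- The moments of the distribution with density `φ` agree with those of `μ` up to order `r`. -/
def MatchesMoments (r : ℕ) (φ : Polynomial ℝ) : Prop :=
  ∀ k : ℕ, 1 ≤ k → k ≤ r → ∫ x, x ^ k * φ.eval x ∂gauss = ∫ x, x ^ k ∂gauss

/-! ### The constants attached to a polynomial density

Throughout, `N` is the degree of `φ` and `K = r + 1`. -/

/-- The threshold `a_φ = (1 + N / (r + 1)) ^ (-1/4)`; by convention it is `0` for `φ = 1`. -/
def aPhi (r : ℕ) (φ : Polynomial ℝ) : ℝ :=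
  open Classical in
  if φ = 1 then 0 else (1 + (φ.natDegree : ℝ) / ((r : ℝ) + 1)) ^ (-(1 / 4) : ℝ)

/-- The function `d_φ`; the sum is empty for `φ = 1`. -/
def dPhi (r : ℕ) (φ : Polynomial ℝ) (a : ℝ) : ℝ :=
  ∑ k ∈ Finset.Icc (r + 1) φ.natDegree,
    |hermiteCoeff (fun x => φ.eval x) k| / √(k.factorial : ℝ) *
      (-2 * ((r : ℝ) + 1 + φ.natDegree) * (1 + (φ.natDegree : ℝ) / ((r : ℝ) + 1)) *
        Real.log a) ^ ((k : ℝ) / 2)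

/-- The numbers `γ_k = (1 + N / K) ^ (k / 2) * |φ_k| / √(k!)`. -/
def gammaCoeff (K : ℕ) (φ : Polynomial ℝ) (k : ℕ) : ℝ :=
  1 / √(k.factorial : ℝ) * (1 + (φ.natDegree : ℝ) / (K : ℝ)) ^ ((k : ℝ) / 2) *
    |hermiteCoeff (fun x => φ.eval x) k|

/-- Hypothesis (H), for `K ≥ 2`. The two parts of (H2a) are the inequalities
`(2 (K+1) γ_{K+1} / N) ^ N * ((K-1) / (2 γ_N)) ^ (K-1) ≤ 1 / (N-K+1) ^ (N-K+1)` and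
`(2 K γ_K / (N-1)) ^ (N-1) * ((K-2) / (2 γ_{N-1})) ^ (K-2) ≤ 1 / (N-K+1) ^ (N-K+1)`,
written with the denominators cleared, which gives them their meaning
when `γ_{N-1}` vanishes; `0 ^ 0 = 1`. -/
structure HypH (K : ℕ) (φ : Polynomial ℝ) : Prop where
  h1 : ∀ k : ℕ, K ≤ k → k + 2 ≤ φ.natDegree →
    ((k : ℝ) + 2) * gammaCoeff K φ (k + 2) ≤ gammaCoeff K φ k
  h2a_fst : K + 1 ≤ φ.natDegree →
    (2 * ((K : ℝ) + 1) * gammaCoeff K φ (K + 1) / φ.natDegree) ^ φ.natDegree *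
        ((K : ℝ) - 1) ^ (K - 1) *
        ((φ.natDegree : ℝ) - K + 1) ^ (φ.natDegree - K + 1)
      ≤ (2 * gammaCoeff K φ φ.natDegree) ^ (K - 1)
  h2a_snd : K + 1 ≤ φ.natDegree →
    (2 * (K : ℝ) * gammaCoeff K φ K / ((φ.natDegree : ℝ) - 1)) ^ (φ.natDegree - 1) *
        ((K : ℝ) - 2) ^ (K - 2) *
        ((φ.natDegree : ℝ) - K + 1) ^ (φ.natDegree - K + 1)
      ≤ (2 * gammaCoeff K φ (φ.natDegree - 1)) ^ (K - 2)
  h2b : φ.natDegree = K →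
    gammaCoeff K φ φ.natDegree ≤
      1 / (2 * ((φ.natDegree : ℝ) - 2) ^ (((φ.natDegree : ℝ) - 2) / 2))

/-! ### The transition operator on `L²(μ)` and its adjoint -/

/-- `Q_{a,φ}[f](x) = ∫ f (a x + √(1 - a²) y) φ(y) dμ(y)`, as a function. -/
def transFn (a : ℝ) (φ f : ℝ → ℝ) (x : ℝ) : ℝ :=
  ∫ y, f (a * x + √(1 - a ^ 2) * y) * φ y ∂gauss

theorem measurePreserving_rot {a : ℝ} (ha : a ∈ Set.Icc (0 : ℝ) 1) :
    MeasurePreserving (fun p : ℝ × ℝ => a * p.1 + √(1 - a ^ 2) * p.2)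
      (gauss.prod gauss) gauss := by
  refine ⟨by fun_prop, ?_⟩
  have h1 : (fun p : ℝ × ℝ => a * p.1 + √(1 - a ^ 2) * p.2) =
      (fun p : ℝ × ℝ => p.1 + p.2) ∘ Prod.map (fun x => a * x) (fun y => √(1 - a ^ 2) * y) := by
    funext p; rfl
  rw [h1, ← Measure.map_map (by fun_prop) (by fun_prop),
    ← Measure.map_prod_map _ _ (by fun_prop) (by fun_prop),
    gaussianReal_map_const_mul, gaussianReal_map_const_mul]
  have h2 := gaussianReal_conv_gaussianReal (m₁ := a * 0) (m₂ := √(1 - a ^ 2) * 0)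
    (v₁ := ⟨a ^ 2, sq_nonneg _⟩ * 1) (v₂ := ⟨√(1 - a ^ 2) ^ 2, sq_nonneg _⟩ * 1)
  rw [Measure.conv] at h2
  refine h2.trans ?_
  congr 1
  · simp
  · ext
    have : (0 : ℝ) ≤ 1 - a ^ 2 := by nlinarith [ha.1, ha.2]
    change a ^ 2 * 1 + √(1 - a ^ 2) ^ 2 * 1 = 1
    rw [Real.sq_sqrt this]
    ring

theorem eLpNorm_two_sq (f : ℝ → ℝ) :
    eLpNorm f 2 gauss ^ 2 = ∫⁻ x, ‖f x‖ₑ ^ 2 ∂gauss := by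
  have := eLpNorm_nnreal_pow_eq_lintegral (μ := gauss) (f := f) (p := 2) (by norm_num)
  simpa using this

theorem aestronglyMeasurable_integrand {a : ℝ} (ha : a ∈ Set.Icc (0 : ℝ) 1) {φ f : ℝ → ℝ}
    (hφ : MemLp φ 2 gauss) (hf : MemLp f 2 gauss) :
    AEStronglyMeasurable (fun p : ℝ × ℝ => f (a * p.1 + √(1 - a ^ 2) * p.2) * φ p.2)
      (gauss.prod gauss) :=
  (hf.1.comp_measurePreserving (measurePreserving_rot ha)).mul hφ.1.comp_snd

theorem integrable_integrand {a : ℝ} (ha : a ∈ Set.Icc (0 : ℝ) 1) {φ f : ℝ → ℝ}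
    (hφ : MemLp φ 2 gauss) (hf : MemLp f 2 gauss) :
    Integrable (fun p : ℝ × ℝ => f (a * p.1 + √(1 - a ^ 2) * p.2) * φ p.2)
      (gauss.prod gauss) :=
  (hf.comp_measurePreserving (measurePreserving_rot ha)).integrable_mul
    (hφ.comp_snd gauss)

theorem eLpNorm_transFn_le {a : ℝ} (ha : a ∈ Set.Icc (0 : ℝ) 1) {φ f : ℝ → ℝ}
    (hφ : MemLp φ 2 gauss) (hf : MemLp f 2 gauss) :
    eLpNorm (transFn a φ f) 2 gauss ≤ eLpNorm φ 2 gauss * eLpNorm f 2 gauss := by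
  have hcomp := hf.1.comp_measurePreserving (measurePreserving_rot ha)
  have key : ∀ᵐ x ∂gauss, ‖transFn a φ f x‖ₑ ^ 2 ≤
      (∫⁻ y, ‖f (a * x + √(1 - a ^ 2) * y)‖ₑ ^ 2 ∂gauss) * eLpNorm φ 2 gauss ^ 2 := by
    filter_upwards [hcomp.prodMk_left] with x hx
    have h1 : ‖transFn a φ f x‖ₑ ≤
        ∫⁻ y, (fun y => ‖f (a * x + √(1 - a ^ 2) * y)‖ₑ) y * (fun y => ‖φ y‖ₑ) y ∂gauss := by
      refine (enorm_integral_le_lintegral_enorm _).trans (le_of_eq ?_)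
      simp [enorm_mul]
    have h2 := ENNReal.lintegral_mul_le_Lp_mul_Lq gauss
      (Real.HolderConjugate.two_two) (f := fun y => ‖f (a * x + √(1 - a ^ 2) * y)‖ₑ)
      (g := fun y => ‖φ y‖ₑ) hx.enorm hφ.1.enorm
    have h3 := pow_le_pow_left' (h1.trans h2) 2
    refine h3.trans (le_of_eq ?_)
    rw [mul_pow, eLpNorm_two_sq, ← ENNReal.rpow_natCast, ← ENNReal.rpow_natCast,
      ← ENNReal.rpow_mul, ← ENNReal.rpow_mul]
    simp
  have h4 : eLpNorm (transFn a φ f) 2 gauss ^ 2 ≤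
      (eLpNorm φ 2 gauss * eLpNorm f 2 gauss) ^ 2 := by
    rw [eLpNorm_two_sq (transFn a φ f)]
    refine (lintegral_mono_ae key).trans ?_
    rw [lintegral_mul_const' _ _ (ENNReal.pow_ne_top hφ.2.ne), mul_pow, mul_comm]
    gcongr
    have h5 : ∫⁻ p, ‖f (a * p.1 + √(1 - a ^ 2) * p.2)‖ₑ ^ 2 ∂(gauss.prod gauss) =
        ∫⁻ x, ‖f x‖ₑ ^ 2 ∂gauss := by
      have h6 : AEMeasurable (fun x => ‖f x‖ₑ ^ 2) (Measure.map
          (fun p : ℝ × ℝ => a * p.1 + √(1 - a ^ 2) * p.2) (gauss.prod gauss)) := by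
        rw [(measurePreserving_rot ha).map_eq]
        exact hf.1.enorm.pow_const 2
      have h7 := lintegral_map' h6 (measurePreserving_rot ha).measurable.aemeasurable
      rw [(measurePreserving_rot ha).map_eq] at h7
      exact h7.symm
    rw [eLpNorm_two_sq f, ← h5]
    exact (lintegral_prod _ (hcomp.enorm.pow_const 2)).ge
  exact (ENNReal.pow_le_pow_left_iff two_ne_zero).1 h4

theorem memLp_transFn {a : ℝ} (ha : a ∈ Set.Icc (0 : ℝ) 1) {φ f : ℝ → ℝ}
    (hφ : MemLp φ 2 gauss) (hf : MemLp f 2 gauss) : MemLp (transFn a φ f) 2 gauss :=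
  ⟨(aestronglyMeasurable_integrand ha hφ hf).integral_prod_right',
    (eLpNorm_transFn_le ha hφ hf).trans_lt (ENNReal.mul_lt_top hφ.2 hf.2)⟩

theorem transFn_congr {a : ℝ} (ha : a ∈ Set.Icc (0 : ℝ) 1) (φ : ℝ → ℝ) {f g : ℝ → ℝ}
    (h : f =ᵐ[gauss] g) : transFn a φ f =ᵐ[gauss] transFn a φ g := by
  have h1 := (measurePreserving_rot ha).quasiMeasurePreserving.ae h
  filter_upwards [Measure.ae_ae_of_ae_prod h1] with x hx
  refine integral_congr_ae ?_
  filter_upwards [hx] with y hy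
  simp only [hy]

theorem transFn_add {a : ℝ} (ha : a ∈ Set.Icc (0 : ℝ) 1) {φ f g : ℝ → ℝ}
    (hφ : MemLp φ 2 gauss) (hf : MemLp f 2 gauss) (hg : MemLp g 2 gauss) :
    transFn a φ (f + g) =ᵐ[gauss] transFn a φ f + transFn a φ g := by
  filter_upwards [(integrable_integrand ha hφ hf).prod_right_ae,
    (integrable_integrand ha hφ hg).prod_right_ae] with x h1 h2
  simp only [transFn, Pi.add_apply, add_mul]
  exact integral_add h1 h2

theorem transFn_smul (a : ℝ) (φ f : ℝ → ℝ) (c : ℝ) :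
    transFn a φ (c • f) = c • transFn a φ f := by
  funext x
  simp only [transFn, Pi.smul_apply, smul_eq_mul, mul_assoc]
  exact integral_const_mul _ _

/-- The linear map `Q_{a,φ}` on `L²(μ)`, for `a ∈ [0, 1]` and `φ ∈ L²(μ)`. -/
def transLin (a : ℝ) (ha : a ∈ Set.Icc (0 : ℝ) 1) (φ : ℝ → ℝ) (hφ : MemLp φ 2 gauss) :
    L2 →ₗ[ℝ] L2 where
  toFun f := (memLp_transFn ha hφ (Lp.memLp f)).toLp (transFn a φ f)
  map_add' f g := by
    rw [← MemLp.toLp_add, MemLp.toLp_eq_toLp_iff]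
    exact (transFn_congr ha φ (Lp.coeFn_add f g)).trans
      (transFn_add ha hφ (Lp.memLp f) (Lp.memLp g))
  map_smul' c f := by
    rw [RingHom.id_apply, ← MemLp.toLp_const_smul, MemLp.toLp_eq_toLp_iff]
    exact (transFn_congr ha φ (Lp.coeFn_smul c f)).trans
      (Filter.EventuallyEq.of_eq (transFn_smul a φ f c))

theorem norm_transLin_le (a : ℝ) (ha : a ∈ Set.Icc (0 : ℝ) 1) (φ : ℝ → ℝ)
    (hφ : MemLp φ 2 gauss) (f : L2) :
    ‖transLin a ha φ hφ f‖ ≤ (eLpNorm φ 2 gauss).toReal * ‖f‖ := by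
  have h1 : ‖transLin a ha φ hφ f‖ = (eLpNorm (transFn a φ f) 2 gauss).toReal :=
    Lp.norm_toLp _ (memLp_transFn ha hφ (Lp.memLp f))
  rw [h1, Lp.norm_def f, ← ENNReal.toReal_mul]
  exact ENNReal.toReal_mono (ENNReal.mul_lt_top hφ.2 (Lp.memLp f).2).ne
    (eLpNorm_transFn_le ha hφ (Lp.memLp f))

/-- The bounded operator `Q_{a,φ}` on `L²(μ)`, for `a ∈ [0, 1]` and `φ ∈ L²(μ)`. -/
def transOp (a : ℝ) (ha : a ∈ Set.Icc (0 : ℝ) 1) (φ : ℝ → ℝ) (hφ : MemLp φ 2 gauss) :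
    L2 →L[ℝ] L2 :=
  (transLin a ha φ hφ).mkContinuous (eLpNorm φ 2 gauss).toReal (norm_transLin_le a ha φ hφ)

theorem transOp_coeFn (a : ℝ) (ha : a ∈ Set.Icc (0 : ℝ) 1) (φ : ℝ → ℝ) (hφ : MemLp φ 2 gauss)
    (f : L2) : transOp a ha φ hφ f =ᵐ[gauss] transFn a φ f :=
  MemLp.coeFn_toLp (memLp_transFn ha hφ (Lp.memLp f))

/-- The operator `Q*_{a,φ}`, the adjoint of `Q_{a,φ}` in `L²(μ)`. -/
def transOpAdj (a : ℝ) (ha : a ∈ Set.Icc (0 : ℝ) 1) (φ : ℝ → ℝ) (hφ : MemLp φ 2 gauss) :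
    L2 →L[ℝ] L2 :=
  ContinuousLinearMap.adjoint (transOp a ha φ hφ)

/-! ### Side facts needed to apply the operator to a polynomial density -/

theorem memLp_eval (φ : Polynomial ℝ) : MemLp (fun x => φ.eval x) 2 gauss := by
  induction φ using Polynomial.induction_on' with
  | add p q hp hq =>
    simp only [Polynomial.eval_add]
    exact hp.add hq
  | monomial n c =>
    have h : MemLp (fun x : ℝ => x ^ n) 2 gauss := by
      rcases Nat.eq_zero_or_pos n with rfl | hn
      · simpa using memLp_const (μ := gauss) (p := 2) (1 : ℝ)
      have h0 : MemLp (id : ℝ → ℝ) (2 * n : ℝ≥0∞) gauss :=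
        memLp_id_gaussianReal' _ (ENNReal.mul_ne_top (by simp) (by simp))
      have h1 := h0.norm_rpow_div (n : ℝ≥0∞)
      rw [ENNReal.mul_div_cancel_right (by exact_mod_cast hn.ne') (by simp)] at h1
      refine (memLp_norm_iff (by fun_prop)).1 (h1.ae_eq ?_)
      filter_upwards with x
      simp
    simp only [Polynomial.eval_monomial]
    exact h.const_mul c

theorem mem_Icc_of_mem_Ioo_aPhi {r : ℕ} {φ : Polynomial ℝ} {a : ℝ}
    (ha : a ∈ Set.Ioo (aPhi r φ) 1) : a ∈ Set.Icc (0 : ℝ) 1 := by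
  refine ⟨le_trans ?_ ha.1.le, ha.2.le⟩
  unfold aPhi
  split_ifs
  · exact le_rfl
  · positivity

end BaryConv

end

noncomputable section

namespace BaryConv

open Polynomial

/-! In the Hermite basis `Q*_{a,φ}` is lower triangular: its entry at `(n, n - k)` is `√(n.choose k)
a^(n-k) (1-a²)^(k/2) φ_k` (`hermiteCoeff_transOpAdj`). On functions without coefficients below `K =
r + 1`, Schur's test bounds the norm by any common bound `M` of absolute row and column sums; here
`M = a^K (1 + d_φ(a))`.

Put `t = -2 log a`. From `n.choose k ≤ n^k / k!` and `1 - a² ≤ t`, both kinds of sums are at most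
`a^n (1 + ∑ γ_k u^k)` with `u = √(n t)` and `n ≥ K` the index of the row or column (`entry_le_row`,
`entry_le_col`). Moment matching leaves only `φ_0 = 1` and `K ≤ k ≤ N`.

Since `a^n = exp(-u²/2)`, everything rests on `u ↦ exp(-u²/2) (1 + ∑ γ_k u^k)` being decreasing
(`antitoneOn_exp_mul_growth`), which is what (H) provides: the worst index is then `n = K`, and the
value there is at most `M`. Parseval's identity, hence completeness of the Hermite system, turns the
matrix bound into the integral bound. -/

/-! ### Gaussian integrals of polynomials -/

theorem integrable_eval (p : ℝ[X]) : Integrable (fun x => p.eval x) gauss :=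
  (memLp_eval p).integrable (by norm_num)

/-- Integration of polynomials against the standard normal distribution. -/
def gaussE : ℝ[X] →ₗ[ℝ] ℝ where
  toFun p := ∫ x, p.eval x ∂gauss
  map_add' p q := by
    simp only [eval_add]
    exact integral_add (integrable_eval p) (integrable_eval q)
  map_smul' c p := by
    simp only [eval_smul, smul_eq_mul, RingHom.id_apply]
    exact integral_const_mul _ _

theorem gaussE_apply (p : ℝ[X]) : gaussE p = ∫ x, p.eval x ∂gauss := rfl

theorem gaussE_C (c : ℝ) : gaussE (C c) = c := by
  simp [gaussE_apply]

theorem gaussE_C_mul (c : ℝ) (p : ℝ[X]) : gaussE (C c * p) = c * gaussE p := by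
  rw [← smul_eq_C_mul, map_smul, smul_eq_mul]

theorem integrable_gaussianPDFReal_mul_eval (p : ℝ[X]) :
    Integrable (fun x => gaussianPDFReal 0 1 x * p.eval x) := by
  have h := integrable_eval p
  rw [gauss, gaussianReal_of_var_ne_zero _ one_ne_zero,
    integrable_withDensity_iff_integrable_smul' (measurable_gaussianPDF 0 1)
      (Filter.Eventually.of_forall fun x => gaussianPDF_lt_top)] at h
  simpa only [toReal_gaussianPDF, smul_eq_mul] using h

theorem hasDerivAt_gaussianPDFReal (x : ℝ) :
    HasDerivAt (gaussianPDFReal 0 1) (-x * gaussianPDFReal 0 1 x) x := by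
  rw [gaussianPDFReal_def]
  have h : HasDerivAt (fun x : ℝ => -(x - 0) ^ 2 / (2 * ((1 : ℝ≥0) : ℝ))) (-x) x := by
    have := (((hasDerivAt_id x).sub_const 0).pow 2).neg.div_const (2 * ((1 : ℝ≥0) : ℝ))
    refine this.congr_deriv ?_
    simp only [id, sub_zero, NNReal.coe_one]
    norm_num
    ring
  refine (h.exp.const_mul _).congr_deriv ?_
  ring

/-- Gaussian integration by parts for polynomials. -/
theorem gaussE_X_mul (p : ℝ[X]) : gaussE (X * p) = gaussE (derivative p) := by
  -- The density times `p' - x p` is the derivative of the density times `p`; both are integrable,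
  -- so the integral vanishes.
  have h := integral_eq_zero_of_hasDerivAt_of_integrable
    (f := fun x => gaussianPDFReal 0 1 x * p.eval x)
    (f' := fun x => gaussianPDFReal 0 1 x * (derivative p - X * p).eval x)
    (fun x => ((hasDerivAt_gaussianPDFReal x).mul (p.hasDerivAt x)).congr_deriv
      (by simp only [eval_sub, eval_mul, eval_X]; ring))
    (integrable_gaussianPDFReal_mul_eval _) (integrable_gaussianPDFReal_mul_eval p)
  have h2 : gaussE (derivative p - X * p) = 0 := by
    rw [gaussE_apply, integral_gaussianReal_eq_integral_smul one_ne_zero]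
    exact h
  rw [map_sub] at h2
  linarith

/-! ### Hermite polynomials: derivatives and orthogonality -/

/-- The Hermite polynomials over the reals. -/
def hermiteR (n : ℕ) : ℝ[X] := (hermite n).map (Int.castRingHom ℝ)

theorem hermiteFn_eq (n : ℕ) (x : ℝ) :
    hermiteFn n x = (hermiteR n).eval x / √(n.factorial : ℝ) := rfl

theorem hermiteR_zero : hermiteR 0 = 1 := by simp [hermiteR]

theorem hermiteR_succ (n : ℕ) :
    hermiteR (n + 1) = X * hermiteR n - derivative (hermiteR n) := by
  simp [hermiteR, derivative_map]

theorem derivative_hermiteR_succ (n : ℕ) :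
    derivative (hermiteR (n + 1)) = C ((n : ℝ) + 1) * hermiteR n := by
  induction n with
  | zero => simp [hermiteR_succ, hermiteR_zero]
  | succ n ih =>
    rw [hermiteR_succ (n + 1), derivative_sub, derivative_mul, derivative_X, ih,
      derivative_C_mul, hermiteR_succ n]
    push_cast
    simp only [C_add, C_1]
    ring

theorem derivative_hermiteR (n : ℕ) :
    derivative (hermiteR n) = C (n : ℝ) * hermiteR (n - 1) := by
  cases n with
  | zero => simp [hermiteR_zero]
  | succ n => rw [derivative_hermiteR_succ]; simp

/-- For `k > n` the truncated index `n - k` is harmless, because the descending factorial is zero.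
-/
theorem iterate_derivative_hermiteR (n k : ℕ) :
    derivative^[k] (hermiteR n) = C (n.descFactorial k : ℝ) * hermiteR (n - k) := by
  induction k with
  | zero => simp
  | succ k ih =>
    rw [Function.iterate_succ_apply', ih, derivative_C_mul, derivative_hermiteR, ← mul_assoc,
      ← C_mul, Nat.sub_sub, Nat.descFactorial_succ, Nat.cast_mul, mul_comm ((n - k : ℕ) : ℝ)]

/-- The raising operator `p ↦ X p - p'` is adjoint to differentiation, so `n` integrations by parts
move it onto `q`. -/
theorem gaussE_hermiteR_mul (n : ℕ) (q : ℝ[X]) :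
    gaussE (hermiteR n * q) = gaussE (derivative^[n] q) := by
  induction n generalizing q with
  | zero => simp [hermiteR_zero]
  | succ n ih =>
    rw [Function.iterate_succ_apply, ← ih, hermiteR_succ, sub_mul, mul_assoc, map_sub,
      gaussE_X_mul, derivative_mul, map_add]
    ring

theorem hermiteCoeff_eval (q : ℝ[X]) (k : ℕ) :
    hermiteCoeff (fun x => q.eval x) k = gaussE (hermiteR k * q) / √(k.factorial : ℝ) := by
  rw [gaussE_apply, ← integral_div]
  unfold hermiteCoeff
  congr 1
  funext x
  rw [hermiteFn_eq, eval_mul]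
  ring

theorem gaussE_hermiteR_mul_hermiteR (j k : ℕ) :
    gaussE (hermiteR k * hermiteR j) = if j = k then (k.factorial : ℝ) else 0 := by
  rcases lt_trichotomy j k with h | h | h
  · rw [gaussE_hermiteR_mul, iterate_derivative_hermiteR, Nat.descFactorial_of_lt h, if_neg h.ne]
    simp
  · subst h
    rw [gaussE_hermiteR_mul, iterate_derivative_hermiteR, Nat.descFactorial_self, if_pos rfl,
      Nat.sub_self, hermiteR_zero, mul_one, gaussE_C]
  · rw [mul_comm, gaussE_hermiteR_mul, iterate_derivative_hermiteR, Nat.descFactorial_of_lt h,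
      if_neg h.ne']
    simp

/-! ### Action of the operator on Hermite polynomials -/

theorem derivative_comp_affine (p : ℝ[X]) (c b : ℝ) :
    derivative (p.comp (C c + C b * X)) = C b * (derivative p).comp (C c + C b * X) := by
  rw [derivative_comp]
  simp

theorem iterate_derivative_comp_affine (p : ℝ[X]) (c b : ℝ) (k : ℕ) :
    derivative^[k] (p.comp (C c + C b * X)) =
      C (b ^ k) * (derivative^[k] p).comp (C c + C b * X) := by
  induction k with
  | zero => simp
  | succ k ih =>
    rw [Function.iterate_succ_apply', ih, derivative_C_mul, derivative_comp_affine, ← mul_assoc,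
      ← C_mul, ← pow_succ, Function.iterate_succ_apply']

/-- Hermite polynomials are eigenfunctions of the Mehler semigroup. -/
theorem gaussE_hermiteR_comp {a b : ℝ} (hab : a ^ 2 + b ^ 2 = 1) (x : ℝ) (n : ℕ) :
    gaussE ((hermiteR n).comp (C (a * x) + C b * X)) = a ^ n * (hermiteR n).eval x := by
  induction n using Nat.strong_induction_on with
  | _ n ih =>
    cases n with
    | zero =>
      rw [hermiteR_zero, one_comp, ← C_1, gaussE_C]
      simp
    | succ n =>
      have h1 : (hermiteR (n + 1)).comp (C (a * x) + C b * X) =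
          C (a * x) * (hermiteR n).comp (C (a * x) + C b * X) +
          C b * (X * (hermiteR n).comp (C (a * x) + C b * X)) -
          (derivative (hermiteR n)).comp (C (a * x) + C b * X) := by
        rw [hermiteR_succ, sub_comp, mul_comp, X_comp]
        ring
      -- Integrating by parts, the `b X` term becomes `b²` times the derivative term, so the two
      -- combine with factor `b² - 1 = -a²`, rebuilding the recurrence for `n + 1`. The derivative
      -- has index `n - 1`, hence strong induction.
      rw [h1, map_sub, map_add, gaussE_C_mul, gaussE_C_mul, gaussE_X_mul, derivative_comp_affine,
        gaussE_C_mul, ih n (Nat.lt_succ_self n), hermiteR_succ n, derivative_hermiteR, mul_comp,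
        C_comp, gaussE_C_mul]
      cases n with
      | zero => simp [hermiteR_zero]
      | succ m =>
        rw [Nat.add_sub_cancel, ih m (by omega)]
        simp only [eval_sub, eval_mul, eval_X, eval_C]
        have : b ^ 2 = 1 - a ^ 2 := by linarith
        linear_combination ((m + 1 : ℕ) : ℝ) * a ^ m * eval x (hermiteR m) * this

theorem gaussE_hermiteR_comp_mul {a b : ℝ} (hab : a ^ 2 + b ^ 2 = 1) (x : ℝ) (n k : ℕ) :
    gaussE ((hermiteR n).comp (C (a * x) + C b * X) * hermiteR k) =
      b ^ k * n.descFactorial k * a ^ (n - k) * (hermiteR (n - k)).eval x := by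
  rw [mul_comm, gaussE_hermiteR_mul, iterate_derivative_comp_affine, iterate_derivative_hermiteR,
    mul_comp, C_comp, gaussE_C_mul, gaussE_C_mul, gaussE_hermiteR_comp hab]
  ring

/-- The Hermite polynomials as a polynomial sequence. -/
def hermiteSeq : Polynomial.Sequence ℝ where
  elems' := hermiteR
  degree_eq' n := by
    rw [hermiteR, (hermite_monic n).degree_map, degree_hermite]

theorem span_hermiteR : Submodule.span ℝ (Set.range hermiteR) = ⊤ :=
  hermiteSeq.span fun i => (isUnit_iff_ne_zero.2 <| leadingCoeff_ne_zero.2 (hermiteSeq.ne_zero i))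

/-- Converts the coefficient for monic Hermite polynomials into the one for normalized ones. -/
theorem descFactorial_div_sqrt {n k : ℕ} (h : k ≤ n) :
    (n.descFactorial k : ℝ) / √(n.factorial : ℝ) =
      √(n.choose k : ℝ) * √(k.factorial : ℝ) / √((n - k).factorial : ℝ) := by
  have h1 : (n.descFactorial k : ℝ) = √(n.choose k : ℝ) ^ 2 * √(k.factorial : ℝ) ^ 2 := by
    rw [Real.sq_sqrt (by positivity), Real.sq_sqrt (by positivity),
      Nat.descFactorial_eq_factorial_mul_choose]
    push_cast; ring
  have h2 : √(n.factorial : ℝ) =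
      √(n.choose k : ℝ) * √(k.factorial : ℝ) * √((n - k).factorial : ℝ) := by
    rw [← Real.sqrt_mul (by positivity), ← Real.sqrt_mul (by positivity)]
    rw [← Nat.choose_mul_factorial_mul_factorial h]
    push_cast
    rfl
  have h3 : 0 < √(n.choose k : ℝ) := Real.sqrt_pos.2 (by exact_mod_cast Nat.choose_pos h)
  rw [h1, h2]
  field_simp

/-- The action of `Q_{a,φ}` on the normalized Hermite polynomials. -/
theorem transFn_hermiteFn {a : ℝ} (ha : a ∈ Set.Icc (0 : ℝ) 1) (φ : ℝ[X]) (n : ℕ) (x : ℝ) :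
    transFn a (fun y => φ.eval y) (hermiteFn n) x =
      ∑ k ∈ Finset.range (n + 1), √(n.choose k : ℝ) * a ^ (n - k) * √(1 - a ^ 2) ^ k *
        hermiteCoeff (fun y => φ.eval y) k * hermiteFn (n - k) x := by
  set b := √(1 - a ^ 2) with hb
  have hab : a ^ 2 + b ^ 2 = 1 := by
    rw [hb, Real.sq_sqrt (by nlinarith [ha.1, ha.2])]; ring
  have h1 : ∀ q : ℝ[X], transFn a (fun y => q.eval y) (hermiteFn n) x =
      gaussE ((hermiteR n).comp (C (a * x) + C b * X) * q) / √(n.factorial : ℝ) := by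
    intro q
    rw [gaussE_apply, ← integral_div]
    unfold transFn
    congr 1
    funext y
    rw [hermiteFn_eq, eval_mul, eval_comp]
    simp only [eval_add, eval_mul, eval_C, eval_X]
    ring
  rw [h1]
  simp only [hermiteCoeff_eval]
  -- Both sides are linear in `φ`, so it may be taken to be a single Hermite polynomial of index
  -- `j`; then only `k = j` survives, and for `j > n` both sides vanish.
  have hφ : φ ∈ Submodule.span ℝ (Set.range hermiteR) := span_hermiteR ▸ Submodule.mem_top
  induction hφ using Submodule.span_induction with
  | mem q hq =>
    obtain ⟨j, rfl⟩ := hq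
    rw [gaussE_hermiteR_comp_mul hab]
    simp only [gaussE_hermiteR_mul_hermiteR]
    by_cases hj : j ≤ n
    · rw [Finset.sum_eq_single_of_mem j (Finset.mem_range.2 (by omega))
        (fun k _ hk => by rw [if_neg hk.symm]; simp), if_pos rfl, Real.div_sqrt, hermiteFn_eq]
      linear_combination b ^ j * a ^ (n - j) * (hermiteR (n - j)).eval x *
        descFactorial_div_sqrt hj
    · rw [Nat.descFactorial_of_lt (by omega), Finset.sum_eq_zero]
      · simp
      · intro k hk
        rw [if_neg (by have := Finset.mem_range.1 hk; omega)]
        simp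
  | zero => simp
  | add p q _ _ hp hq =>
    simp only [mul_add, map_add, add_div, hp, hq, add_mul, Finset.sum_add_distrib]
  | smul c p _ hp =>
    simp only [mul_smul_comm, map_smul, smul_eq_mul, mul_div_assoc] at hp ⊢
    rw [hp, Finset.mul_sum]
    refine Finset.sum_congr rfl fun k _ => ?_
    ring

/-! ### Completeness of polynomials in `L²(μ)` -/

/-- By Cauchy–Schwarz, as exponentials are in `L²(μ)`. This makes the complex moment generating
functions below entire. -/
theorem integrable_ofReal_mul_exp {f : ℝ → ℝ} (hf : MemLp f 2 gauss) (t : ℝ) :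
    Integrable (fun x => Real.exp (t * x)) (gauss.withDensity fun x => ENNReal.ofReal (f x)) := by
  have hexp : MemLp (fun x => Real.exp (t * x)) 2 gauss := by
    refine (memLp_two_iff_integrable_sq (by fun_prop)).2 ?_
    refine (integrable_exp_mul_gaussianReal (μ := 0) (v := 1) (2 * t)).congr ?_
    filter_upwards with x
    rw [← Real.exp_nat_mul]
    congr 1
    push_cast
    ring
  rw [integrable_withDensity_iff_integrable_smul₀' hf.1.aemeasurable.ennreal_ofReal
    (Filter.Eventually.of_forall fun x => ENNReal.ofReal_lt_top)]
  refine (hf.integrable_mul hexp).mono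
    ((hf.1.aemeasurable.ennreal_ofReal.ennreal_toReal.aestronglyMeasurable).smul hexp.1) ?_
  filter_upwards with x
  simp only [norm_smul, Pi.mul_apply, norm_mul, ENNReal.toReal_ofReal', Real.norm_eq_abs]
  refine mul_le_mul_of_nonneg_right ?_ (abs_nonneg _)
  rw [abs_of_nonneg (le_max_right _ _)]
  exact max_le (le_abs_self _) (abs_nonneg _)

theorem isFiniteMeasure_withDensity_of_memLp {f : ℝ → ℝ} (hf : MemLp f 2 gauss) :
    IsFiniteMeasure (gauss.withDensity fun x => ENNReal.ofReal (f x)) :=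
  MeasureTheory.isFiniteMeasure_withDensity_ofReal (hf.integrable (by norm_num)).2

theorem integrableExpSet_withDensity {f : ℝ → ℝ} (hf : MemLp f 2 gauss) :
    integrableExpSet id (gauss.withDensity fun x => ENNReal.ofReal (f x)) = Set.univ :=
  Set.eq_univ_of_forall fun t => integrable_ofReal_mul_exp hf t

theorem integral_withDensity_ofReal {f : ℝ → ℝ} (hf : MemLp f 2 gauss) (g : ℝ → ℂ) :
    ∫ x, g x ∂(gauss.withDensity fun x => ENNReal.ofReal (f x)) =
      ∫ x, (max (f x) 0) • g x ∂gauss := by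
  rw [integral_withDensity_eq_integral_toReal_smul₀ hf.1.aemeasurable.ennreal_ofReal
    (Filter.Eventually.of_forall fun x => ENNReal.ofReal_lt_top)]
  simp only [ENNReal.toReal_ofReal']

theorem memLp_eval_complex (n : ℕ) : MemLp (fun x : ℝ => (x : ℂ) ^ n) 2 gauss := by
  have := (memLp_eval (X ^ n : ℝ[X])).ofReal (K := ℂ)
  simpa using this

/-- A square integrable function all of whose moments vanish is zero. -/
theorem ae_eq_zero_of_moments {f : ℝ → ℝ} (hf : MemLp f 2 gauss)
    (h : ∀ n : ℕ, ∫ x, f x * x ^ n ∂gauss = 0) : f =ᵐ[gauss] 0 := by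
  -- The measures with densities `f⁺` and `f⁻` have equal moments, so their entire moment generating
  -- functions have equal Taylor series at `0` and coincide. The measures are then equal, so `f⁺ =
  -- f⁻` and `f = 0` almost everywhere.
  set μ₁ := gauss.withDensity fun x => ENNReal.ofReal (f x) with hμ₁
  set μ₂ := gauss.withDensity fun x => ENNReal.ofReal (-f x) with hμ₂
  have hfn : MemLp (fun x => -f x) 2 gauss := hf.neg
  have : IsFiniteMeasure μ₁ := isFiniteMeasure_withDensity_of_memLp hf
  have : IsFiniteMeasure μ₂ := isFiniteMeasure_withDensity_of_memLp hfn
  have hz₁ : ∀ z : ℂ, z.re ∈ interior (integrableExpSet id μ₁) := fun z => by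
    rw [integrableExpSet_withDensity hf]; simp
  have hz₂ : ∀ z : ℂ, z.re ∈ interior (integrableExpSet id μ₂) := fun z => by
    rw [integrableExpSet_withDensity hfn]; simp
  have hmax : ∀ {g : ℝ → ℝ}, MemLp g 2 gauss → MemLp (fun x => max (g x) 0) 2 gauss :=
    fun hg => hg.pos_part
  have hmom : ∀ n : ℕ, iteratedDeriv n (complexMGF id μ₁) 0 =
      iteratedDeriv n (complexMGF id μ₂) 0 := by
    intro n
    rw [iteratedDeriv_complexMGF (hz₁ 0), iteratedDeriv_complexMGF (hz₂ 0)]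
    simp only [id, zero_mul, Complex.exp_zero, mul_one]
    rw [hμ₁, hμ₂, integral_withDensity_ofReal hf, integral_withDensity_ofReal hfn, ← sub_eq_zero,
      ← integral_sub]
    · have h1 : ∫ x, ((f x * x ^ n : ℝ) : ℂ) ∂gauss = 0 := by
        rw [integral_complex_ofReal, h n, Complex.ofReal_zero]
      rw [← h1]
      congr 1
      funext x
      rw [← sub_smul, Complex.real_smul]
      push_cast
      congr 1
      norm_cast
      rcases le_total 0 (f x) with h0 | h0
      · rw [max_eq_left h0, max_eq_right (by linarith), sub_zero]
      · rw [max_eq_right h0, max_eq_left (by linarith)]; ring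
    · exact memLp_one_iff_integrable.1 ((memLp_eval_complex n).smul (hmax hf))
    · exact memLp_one_iff_integrable.1 ((memLp_eval_complex n).smul (hmax hfn))
  have heq : complexMGF id μ₁ = complexMGF id μ₂ := by
    have h1 := (analyticAt_complexMGF (hz₁ 0)).hasFPowerSeriesAt
    have h2 := (analyticAt_complexMGF (hz₂ 0)).hasFPowerSeriesAt
    simp only [hmom] at h1
    have h3 : complexMGF id μ₁ =ᶠ[nhds 0] complexMGF id μ₂ := by
      have h4 := h1.sub h2
      rw [sub_self] at h4
      filter_upwards [h4.eventually_eq_zero] with z hz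
      exact sub_eq_zero.1 hz
    exact AnalyticOnNhd.eq_of_eventuallyEq (fun z _ => analyticAt_complexMGF (hz₁ z))
      (fun z _ => analyticAt_complexMGF (hz₂ z)) h3
  have hμ : μ₁ = μ₂ := Measure.ext_of_complexMGF_id_eq heq
  rw [hμ₁, hμ₂, withDensity_eq_iff hf.1.aemeasurable.ennreal_ofReal
    hfn.1.aemeasurable.ennreal_ofReal] at hμ
  · filter_upwards [hμ] with x hx
    have := congrArg ENNReal.toReal hx
    simp only [ENNReal.toReal_ofReal'] at this
    rcases le_total 0 (f x) with h0 | h0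
    · rw [max_eq_left h0, max_eq_right (by linarith)] at this; exact this
    · rw [max_eq_right h0, max_eq_left (by linarith)] at this
      simp only [Pi.zero_apply]; linarith
  · have := measure_ne_top μ₁ Set.univ
    rwa [hμ₁, withDensity_apply _ MeasurableSet.univ, Measure.restrict_univ] at this

/-! ### The Hermite basis, Parseval, and the adjoint -/

theorem memLp_hermiteFn (n : ℕ) : MemLp (hermiteFn n) 2 gauss := by
  have := (memLp_eval (hermiteR n)).mul_const (√(n.factorial : ℝ))⁻¹
  exact this

/-- The normalized Hermite polynomials as elements of `L²(μ)`. -/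
def hermiteL2 (n : ℕ) : L2 := (memLp_hermiteFn n).toLp (hermiteFn n)

theorem coeFn_hermiteL2 (n : ℕ) : hermiteL2 n =ᵐ[gauss] hermiteFn n :=
  (memLp_hermiteFn n).coeFn_toLp

theorem inner_hermiteL2 (n : ℕ) (f : L2) : inner ℝ (hermiteL2 n) f = hermiteCoeff f n := by
  rw [L2.inner_def]
  refine integral_congr_ae ?_
  filter_upwards [coeFn_hermiteL2 n] with x hx
  rw [hx]
  rfl

theorem hermiteCoeff_hermiteFn (j k : ℕ) :
    hermiteCoeff (hermiteFn j) k = if j = k then 1 else 0 := by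
  have h : hermiteFn j = fun x => (C (√(j.factorial : ℝ))⁻¹ * hermiteR j).eval x := by
    funext x
    rw [hermiteFn_eq, eval_mul, eval_C]
    ring
  rw [h, hermiteCoeff_eval, mul_left_comm, gaussE_C_mul, gaussE_hermiteR_mul_hermiteR]
  split_ifs with hjk
  · subst hjk
    have h0 : (0 : ℝ) < j.factorial := by positivity
    rw [mul_div_assoc, Real.div_sqrt, inv_mul_cancel₀ (Real.sqrt_pos.2 h0).ne']
  · simp

theorem hermiteCoeff_congr {f g : ℝ → ℝ} (h : f =ᵐ[gauss] g) (k : ℕ) :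
    hermiteCoeff f k = hermiteCoeff g k := by
  refine integral_congr_ae ?_
  filter_upwards [h] with x hx
  rw [hx]

theorem orthonormal_hermiteL2 : Orthonormal ℝ hermiteL2 := by
  rw [orthonormal_iff_ite]
  intro i j
  rw [inner_hermiteL2, hermiteCoeff_congr (coeFn_hermiteL2 j), hermiteCoeff_hermiteFn]
  simp only [eq_comm]

theorem integral_mul_eval_eq_zero {f : ℝ → ℝ} (hf : MemLp f 2 gauss)
    (h : ∀ n, hermiteCoeff f n = 0) (q : ℝ[X]) : ∫ x, f x * q.eval x ∂gauss = 0 := by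
  have hq : q ∈ Submodule.span ℝ (Set.range hermiteR) := span_hermiteR ▸ Submodule.mem_top
  induction hq using Submodule.span_induction with
  | mem q hq =>
    obtain ⟨j, rfl⟩ := hq
    have h1 := h j
    unfold hermiteCoeff at h1
    simp only [hermiteFn_eq, ← mul_div_assoc] at h1
    rw [integral_div] at h1
    have h0 : (0 : ℝ) < j.factorial := by positivity
    exact (div_eq_zero_iff.1 h1).resolve_right (Real.sqrt_pos.2 h0).ne'
  | zero => simp
  | add p q _ _ hp hq =>
    simp only [eval_add, mul_add]
    rw [integral_add (f := fun x => f x * eval x p) (g := fun x => f x * eval x q) (hf.integrable_mul (memLp_eval p)) (hf.integrable_mul (memLp_eval q)),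
      hp, hq, add_zero]
  | smul c p _ hp =>
    simp only [eval_smul, smul_eq_mul, mul_left_comm _ c]
    rw [integral_const_mul, hp, mul_zero]

theorem orthogonal_span_hermiteL2 : (Submodule.span ℝ (Set.range hermiteL2))ᗮ = ⊥ := by
  rw [Submodule.eq_bot_iff]
  intro f hf
  have h1 : ∀ n, hermiteCoeff f n = 0 := fun n => by
    rw [← inner_hermiteL2]
    exact (Submodule.mem_orthogonal _ _).1 hf _ (Submodule.subset_span ⟨n, rfl⟩)
  have h2 : (f : ℝ → ℝ) =ᵐ[gauss] 0 := ae_eq_zero_of_moments (Lp.memLp f) fun n => by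
    simpa using integral_mul_eval_eq_zero (Lp.memLp f) h1 (X ^ n)
  exact (Lp.eq_zero_iff_ae_eq_zero).2 h2

/-- The Hilbert basis of `L²(μ)` formed by the normalized Hermite polynomials. -/
def hermiteBasis : HilbertBasis ℕ ℝ L2 :=
  HilbertBasis.mkOfOrthogonalEqBot orthonormal_hermiteL2 orthogonal_span_hermiteL2

theorem integral_sq_eq_norm_sq (f : L2) : ∫ x, (f x) ^ 2 ∂gauss = ‖f‖ ^ 2 := by
  rw [← real_inner_self_eq_norm_sq, L2.inner_def]
  congr 1
  funext x
  rw [real_inner_self_eq_norm_sq, Real.norm_eq_abs, sq_abs]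

/-- Parseval's identity for Hermite coefficients. -/
theorem hasSum_hermiteCoeff_sq (f : L2) :
    HasSum (fun n => hermiteCoeff f n ^ 2) (∫ x, (f x) ^ 2 ∂gauss) := by
  have h := hermiteBasis.hasSum_inner_mul_inner f f
  rw [real_inner_self_eq_norm_sq, ← integral_sq_eq_norm_sq] at h
  have hb : ∀ n, hermiteBasis n = hermiteL2 n := fun n =>
    congrFun (HilbertBasis.coe_mkOfOrthogonalEqBot _ _) n
  simpa only [hb, inner_hermiteL2, real_inner_comm (hermiteL2 _) f, ← sq] using h

/-- The Hermite coefficients of `Q*_{a,φ}[g]`. -/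
theorem hermiteCoeff_transOpAdj {a : ℝ} (ha : a ∈ Set.Icc (0 : ℝ) 1) (φ : ℝ[X]) (g : L2) (n : ℕ) :
    hermiteCoeff (transOpAdj a ha (fun y => φ.eval y) (memLp_eval φ) g) n =
      ∑ k ∈ Finset.range (n + 1), √(n.choose k : ℝ) * a ^ (n - k) * √(1 - a ^ 2) ^ k *
        hermiteCoeff (fun y => φ.eval y) k * hermiteCoeff g (n - k) := by
  -- The `n`-th coefficient of `Q* g` is the inner product of `Q H_n` with `g`, and `Q H_n` is a
  -- finite combination, so no series has to be exchanged.
  have h1 : transOp a ha (fun y => φ.eval y) (memLp_eval φ) (hermiteL2 n) =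
      ∑ k ∈ Finset.range (n + 1), (√(n.choose k : ℝ) * a ^ (n - k) * √(1 - a ^ 2) ^ k *
        hermiteCoeff (fun y => φ.eval y) k) • hermiteL2 (n - k) := by
    refine Lp.ext ?_
    have h2 := transOp_coeFn a ha (fun y => φ.eval y) (memLp_eval φ) (hermiteL2 n)
    have h3 := transFn_congr ha (fun y => φ.eval y) (coeFn_hermiteL2 n)
    have h4 := Lp.coeFn_finsetSum (Finset.range (n + 1)) fun k =>
      (√(n.choose k : ℝ) * a ^ (n - k) * √(1 - a ^ 2) ^ k *
        hermiteCoeff (fun y => φ.eval y) k) • hermiteL2 (n - k)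
    have h5 : ∀ᵐ x ∂gauss, ∀ k, ((√(n.choose k : ℝ) * a ^ (n - k) * √(1 - a ^ 2) ^ k *
        hermiteCoeff (fun y => φ.eval y) k) • hermiteL2 (n - k)) x =
        (√(n.choose k : ℝ) * a ^ (n - k) * √(1 - a ^ 2) ^ k *
        hermiteCoeff (fun y => φ.eval y) k) * hermiteFn (n - k) x := by
      rw [ae_all_iff]
      intro k
      filter_upwards [Lp.coeFn_smul (√(n.choose k : ℝ) * a ^ (n - k) * √(1 - a ^ 2) ^ k *
        hermiteCoeff (fun y => φ.eval y) k) (hermiteL2 (n - k)), coeFn_hermiteL2 (n - k)]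
        with x hx1 hx2
      rw [hx1, Pi.smul_apply, hx2, smul_eq_mul]
    filter_upwards [h2, h3, h4, h5] with x hx2 hx3 hx4 hx5
    rw [hx2, hx3, transFn_hermiteFn ha, hx4]
    simp only [Finset.sum_apply, hx5]
  rw [← inner_hermiteL2, transOpAdj, ContinuousLinearMap.adjoint_inner_right, h1, sum_inner]
  refine Finset.sum_congr rfl fun k _ => ?_
  rw [real_inner_smul_left, inner_hermiteL2]

/-! ### Hypothesis (H) and the decreasing function -/

/-- Weighted inequality of arithmetic and geometric means with natural weights. -/
theorem pow_mul_pow_le_add_pow {x y : ℝ} (hx : 0 ≤ x) (hy : 0 ≤ y) (s p : ℕ) (hs : 0 < s) :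
    ((s : ℝ) + p) ^ (s + p) * (x ^ s * y ^ p) ≤
      (s : ℝ) ^ s * (p : ℝ) ^ p * (x + y) ^ (s + p) := by
  rcases Nat.eq_zero_or_pos p with rfl | hp
  · have : x ^ s ≤ (x + y) ^ s := pow_le_pow_left₀ hx (by linarith) s
    simpa using mul_le_mul_of_nonneg_left this (pow_nonneg (Nat.cast_nonneg (α := ℝ) s) s)
  have hs' : (0 : ℝ) < s := by exact_mod_cast hs
  have hp' : (0 : ℝ) < p := by exact_mod_cast hp
  have hq : (0 : ℝ) < s + p := by positivity
  have h := Real.geom_mean_le_arith_mean2_weighted (w₁ := s / (s + p)) (w₂ := p / (s + p))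
    (p₁ := x / s) (p₂ := y / p) (by positivity) (by positivity) (by positivity) (by positivity)
    (by field_simp)
  have h1 : (s : ℝ) / (s + p) * (x / s) + p / (s + p) * (y / p) = (x + y) / (s + p) := by
    field_simp
  rw [h1] at h
  have h2 := pow_le_pow_left₀ (by positivity) h (s + p)
  rw [mul_pow, ← Real.rpow_mul_natCast (by positivity), ← Real.rpow_mul_natCast (by positivity)]
    at h2
  push_cast at h2
  rw [div_mul_cancel₀ _ hq.ne', div_mul_cancel₀ _ hq.ne', Real.rpow_natCast, Real.rpow_natCast,
    div_pow, div_pow, div_pow, div_mul_div_comm, div_le_div_iff₀ (by positivity) (by positivity)]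
    at h2
  linarith

/-- Weighted AM–GM for `1` and `2 e u^(s+p)`. The assumption has the shape of (H2a), with `s = N - K
+ 1` and `p = K - 1` or `p = K - 2`. -/
theorem mul_pow_le_half_add {c e u : ℝ} (he : 0 ≤ e) (hu : 0 ≤ u) (s p : ℕ)
    (hs : 0 < s) (h : (2 * c / ((s : ℝ) + p)) ^ (s + p) * (p : ℝ) ^ p * (s : ℝ) ^ s ≤
      (2 * e) ^ p) : c * u ^ p ≤ 1 / 2 + e * u ^ (s + p) := by
  have hs' : (0 : ℝ) < s := by exact_mod_cast hs
  have hq : (0 : ℝ) < (s : ℝ) + p := by positivity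
  have hpp : (0 : ℝ) < (p : ℝ) ^ p := by
    rcases Nat.eq_zero_or_pos p with rfl | hp
    · simp
    · positivity
  have h1 := pow_mul_pow_le_add_pow zero_le_one (by positivity : 0 ≤ 2 * e * u ^ (s + p)) s p hs
  rw [one_pow, one_mul] at h1
  have h2 : (2 * c * u ^ p) ^ (s + p) ≤ (1 + 2 * e * u ^ (s + p)) ^ (s + p) := by
    rw [div_pow, div_mul_eq_mul_div, div_mul_eq_mul_div, div_le_iff₀ (by positivity)] at h
    have h3 := mul_le_mul_of_nonneg_right h (pow_nonneg (pow_nonneg hu p) (s + p))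
    have h4 : (p : ℝ) ^ p * (s : ℝ) ^ s * (2 * c * u ^ p) ^ (s + p) ≤
        (p : ℝ) ^ p * (s : ℝ) ^ s * (1 + 2 * e * u ^ (s + p)) ^ (s + p) := by
      calc _ = (2 * c) ^ (s + p) * (p : ℝ) ^ p * (s : ℝ) ^ s * (u ^ p) ^ (s + p) := by
            rw [mul_pow (2 * c)]; ring
        _ ≤ _ := h3
        _ = ((s : ℝ) + p) ^ (s + p) * (2 * e * u ^ (s + p)) ^ p := by
            rw [mul_pow (2 * e), ← pow_mul, ← pow_mul, mul_comm p]; ring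
        _ ≤ _ := h1
        _ = _ := by ring
    exact le_of_mul_le_mul_left h4 (by positivity)
  have h5 := le_of_pow_le_pow_left₀ (by omega) (by positivity) h2
  linarith

/-- The case (H2b), with `p = N - 2`: the maximum of `u^p (p + 2 - u²)` is `2 p^(p/2)`, attained at
`u² = p`. -/
theorem mul_pow_le_one_add {c u : ℝ} (hc : 0 ≤ c) (hu : 0 ≤ u) (p : ℕ)
    (h : c ≤ 1 / (2 * (p : ℝ) ^ ((p : ℝ) / 2))) :
    ((p : ℝ) + 2) * c * u ^ p ≤ 1 + c * u ^ (p + 2) := by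
  set D := (p : ℝ) ^ ((p : ℝ) / 2) with hD
  have hD2 : D ^ 2 = (p : ℝ) ^ p := by
    rw [hD, ← Real.rpow_mul_natCast (by positivity)]
    push_cast
    rw [div_mul_cancel₀ _ two_ne_zero, Real.rpow_natCast]
  have hD0 : 0 < D := by
    rcases Nat.eq_zero_or_pos p with rfl | hp
    · simp [hD]
    · positivity
  suffices h1 : u ^ p * ((p : ℝ) + 2 - u ^ 2) ≤ 2 * D by
    have h2 := mul_le_mul_of_nonneg_left h1 hc
    have h3 : c * (2 * D) ≤ 1 := by rwa [le_div_iff₀ (by positivity)] at h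
    rw [pow_add]
    linarith
  rcases le_total ((p : ℝ) + 2) (u ^ 2) with hv | hv
  · exact (mul_nonpos_of_nonneg_of_nonpos (by positivity) (by linarith)).trans (by positivity)
  -- Squaring makes the exponents natural: the numbers `p + 2 - u²` and `u²`, with weights `2` and
  -- `p`, have the constant sum `p + 2`.
  have h4 := pow_mul_pow_le_add_pow (sub_nonneg.2 hv) (sq_nonneg u) 2 p two_pos
  rw [sub_add_cancel] at h4
  refine le_of_pow_le_pow_left₀ two_ne_zero (by positivity) ?_
  have h5 : (0 : ℝ) < ((p : ℝ) + 2) ^ (2 + p) := by positivity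
  rw [mul_pow, mul_pow, hD2, ← pow_mul, mul_comm p 2, pow_mul]
  refine le_of_mul_le_mul_left ?_ h5
  push_cast at h4
  rw [add_comm (2 : ℝ) p] at h4
  linarith

/-- The polynomial `1 + ∑ γ_k u ^ k` attached to a density. -/
def growth (K : ℕ) (φ : ℝ[X]) (u : ℝ) : ℝ :=
  1 + ∑ k ∈ Finset.Icc K φ.natDegree, gammaCoeff K φ k * u ^ k

theorem gammaCoeff_nonneg (K : ℕ) (φ : ℝ[X]) (k : ℕ) : 0 ≤ gammaCoeff K φ k := by
  unfold gammaCoeff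
  positivity

/-- This is the sign condition on the derivative of `exp(-u²/2) growth(u)`, divided by `u`. When `N
> K`, (H1) bounds the term of index `k + 2` on the left by that of index `k` on the right. The
unmatched left terms `K` and `K + 1` are absorbed by the unmatched right terms `N - 1` and `N`, each
helped by half of the constant `1`. -/
theorem sum_mul_gammaCoeff_le_growth {K : ℕ} (hK : 2 ≤ K) {φ : ℝ[X]} (hH : HypH K φ)
    {u : ℝ} (hu : 0 ≤ u) :
    ∑ k ∈ Finset.Icc K φ.natDegree, (k : ℝ) * gammaCoeff K φ k * u ^ (k - 2) ≤
      growth K φ u := by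
  unfold growth
  rcases lt_trichotomy φ.natDegree K with hN | hN | hN
  · simp [Finset.Icc_eq_empty_of_lt hN]
  · obtain ⟨p, rfl⟩ := Nat.exists_eq_add_of_le' hK
    have h := hH.h2b hN
    rw [hN] at h ⊢
    simp only [Finset.Icc_self, Finset.sum_singleton, Nat.add_sub_cancel]
    push_cast at h ⊢
    rw [add_sub_cancel_right] at h
    exact mul_pow_le_one_add (gammaCoeff_nonneg _ _ _) hu p h
  · obtain ⟨p, rfl⟩ := Nat.exists_eq_add_of_le' hK
    obtain ⟨m, hm⟩ := Nat.exists_eq_add_of_lt hN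
    have h1 := hH.h1
    have ha := hH.h2a_fst hN
    have hb := hH.h2a_snd hN
    rw [hm] at h1 ha hb ⊢
    have e1 : p + 2 + m + 1 - (p + 2) + 1 = m + 2 := by omega
    have e2 : p + 2 - 1 = p + 1 := by omega
    have e3 : p + 2 + m + 1 - 1 = m + 2 + p := by omega
    have e4 : p + 2 + m + 1 = m + 2 + (p + 1) := by omega
    have A := mul_pow_le_half_add (c := ((p + 2 : ℕ) + 1 : ℝ) * gammaCoeff (p + 2) φ (p + 2 + 1))
      (e := gammaCoeff (p + 2) φ (p + 2 + m + 1)) (u := u) (gammaCoeff_nonneg _ _ _) hu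
      (m + 2) (p + 1) (by omega) (by
        rw [e1, e2, e4] at ha
        convert ha using 2
        · push_cast; ring_nf
        · push_cast; ring_nf
        · rw [e4])
    have B := mul_pow_le_half_add (c := ((p + 2 : ℕ) : ℝ) * gammaCoeff (p + 2) φ (p + 2))
      (e := gammaCoeff (p + 2) φ (p + 2 + m)) (u := u) (gammaCoeff_nonneg _ _ _) hu
      (m + 2) p (by omega) (by
        rw [e1, e3, Nat.add_sub_cancel] at hb
        have e5 : m + 2 + p = p + 2 + m := by omega
        rw [← e5]
        convert hb using 2
        · push_cast; ring_nf
        · push_cast; ring_nf)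
    have hs : ∀ f : ℕ → ℝ, ∑ k ∈ Finset.Icc (p + 2) (p + 2 + m + 1), f k =
        ∑ j ∈ Finset.range (m + 2), f (p + 2 + j) := by
      intro f
      rw [← Finset.Ico_succ_right_eq_Icc, Finset.sum_Ico_eq_sum_range]
      congr 2
      simp only [Order.succ_eq_add_one]
      omega
    -- Split off the two lowest terms on the left and the two highest on the right.
    rw [hs, hs, Finset.sum_range_succ', Finset.sum_range_succ', Finset.sum_range_succ,
      Finset.sum_range_succ]
    have C : ∑ k ∈ Finset.range m, ((p + 2 + (k + 1 + 1) : ℕ) : ℝ) *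
        gammaCoeff (p + 2) φ (p + 2 + (k + 1 + 1)) * u ^ (p + 2 + (k + 1 + 1) - 2) ≤
        ∑ k ∈ Finset.range m, gammaCoeff (p + 2) φ (p + 2 + k) * u ^ (p + 2 + k) := by
      refine Finset.sum_le_sum fun k hk => ?_
      have hk' := Finset.mem_range.1 hk
      have h := h1 (p + 2 + k) (by omega) (by omega)
      have e6 : p + 2 + (k + 1 + 1) - 2 = p + 2 + k := by omega
      have e7 : p + 2 + (k + 1 + 1) = p + 2 + k + 2 := by omega
      rw [e6, e7]
      refine mul_le_mul_of_nonneg_right ?_ (pow_nonneg hu _)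
      push_cast at h ⊢
      exact h
    have e8 : p + 2 + (0 + 1) - 2 = p + 1 := by omega
    have e9 : m + 2 + p = p + 2 + m := by omega
    rw [e8]
    rw [← e4] at A
    rw [e9] at B
    simp only [add_zero, zero_add, Nat.add_sub_cancel, ← add_assoc] at A B C ⊢
    push_cast at A B C ⊢
    linarith

theorem hasDerivAt_growth (K : ℕ) (φ : ℝ[X]) (u : ℝ) :
    HasDerivAt (growth K φ)
      (∑ k ∈ Finset.Icc K φ.natDegree, gammaCoeff K φ k * ((k : ℝ) * u ^ (k - 1))) u :=
  (HasDerivAt.fun_sum fun k _ => (hasDerivAt_pow k u).const_mul (gammaCoeff K φ k)).const_add 1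

/-- Under hypothesis (H) the function `exp (-u² / 2) (1 + ∑ γ_k u ^ k)` decreases. -/
theorem antitoneOn_exp_mul_growth {K : ℕ} (hK : 2 ≤ K) {φ : ℝ[X]} (hH : HypH K φ) :
    AntitoneOn (fun u => Real.exp (-u ^ 2 / 2) * growth K φ u) (Set.Ici 0) := by
  have hd : ∀ u, HasDerivAt (fun u => Real.exp (-u ^ 2 / 2) * growth K φ u)
      (Real.exp (-u ^ 2 / 2) * (∑ k ∈ Finset.Icc K φ.natDegree,
        gammaCoeff K φ k * ((k : ℝ) * u ^ (k - 1)) - u * growth K φ u)) u := by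
    intro u
    have h1 : HasDerivAt (fun u : ℝ => -u ^ 2 / 2) (-u) u :=
      ((hasDerivAt_pow 2 u).neg.div_const 2).congr_deriv (by push_cast; ring)
    exact (h1.exp.mul (hasDerivAt_growth K φ u)).congr_deriv (by ring)
  refine antitoneOn_of_deriv_nonpos (convex_Ici 0)
    (fun u _ => (hd u).continuousAt.continuousWithinAt)
    (fun u _ => (hd u).differentiableAt.differentiableWithinAt) fun u hu => ?_
  rw [interior_Ici, Set.mem_Ioi] at hu
  rw [(hd u).deriv]
  refine mul_nonpos_of_nonneg_of_nonpos (Real.exp_pos _).le (sub_nonpos.2 ?_)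
  refine le_trans (le_of_eq ?_)
    (mul_le_mul_of_nonneg_left (sum_mul_gammaCoeff_le_growth hK hH hu.le) hu.le)
  rw [Finset.mul_sum]
  refine Finset.sum_congr rfl fun k hk => ?_
  have hk' : k - 1 = k - 2 + 1 := by have := (Finset.mem_Icc.1 hk).1; omega
  rw [hk', pow_succ]
  ring

/-! ### Schur's test -/

/-- Schur's test for finite matrices. -/
theorem sum_sq_sum_mul_le {ι : Type*} (s : Finset ι) (B : ι → ι → ℝ) (g : ι → ℝ) {M : ℝ}
    (hrow : ∀ n ∈ s, ∑ m ∈ s, |B n m| ≤ M) (hcol : ∀ m ∈ s, ∑ n ∈ s, |B n m| ≤ M) :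
    ∑ n ∈ s, (∑ m ∈ s, B n m * g m) ^ 2 ≤ M ^ 2 * ∑ m ∈ s, g m ^ 2 := by
  rcases s.eq_empty_or_nonempty with rfl | ⟨i, hi⟩
  · simp
  have hM : 0 ≤ M := (Finset.sum_nonneg fun _ _ => abs_nonneg _).trans (hrow i hi)
  calc ∑ n ∈ s, (∑ m ∈ s, B n m * g m) ^ 2
      ≤ ∑ n ∈ s, M * ∑ m ∈ s, |B n m| * g m ^ 2 := by
        refine Finset.sum_le_sum fun n hn => ?_
        -- Cauchy–Schwarz after splitting `|B g|` as `|B|^(1/2) · |B|^(1/2) |g|`.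
        refine (Finset.sum_sq_le_sum_mul_sum_of_sq_le_mul s (f := fun m => |B n m|)
          (g := fun m => |B n m| * g m ^ 2) (fun m _ => abs_nonneg _)
          (fun m _ => by positivity) fun m _ => le_of_eq ?_).trans ?_
        · rw [mul_pow, ← mul_assoc, ← sq, sq_abs]
        · exact mul_le_mul_of_nonneg_right (hrow n hn)
            (Finset.sum_nonneg fun m _ => by positivity)
    _ = M * ∑ m ∈ s, (∑ n ∈ s, |B n m|) * g m ^ 2 := by
        rw [← Finset.mul_sum, Finset.sum_comm]
        simp only [Finset.sum_mul]
    _ ≤ M * ∑ m ∈ s, M * g m ^ 2 := by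
        refine mul_le_mul_of_nonneg_left (Finset.sum_le_sum fun m hm => ?_) hM
        exact mul_le_mul_of_nonneg_right (hcol m hm) (sq_nonneg _)
    _ = M ^ 2 * ∑ m ∈ s, g m ^ 2 := by
        rw [← Finset.mul_sum]; ring

/-! ### Hermite coefficients of the density -/

theorem gaussE_mul_of_matchesMoments {r : ℕ} {φ : ℝ[X]} (hφ : IsDensity φ)
    (hmom : MatchesMoments r φ) {q : ℝ[X]} (hq : q.natDegree ≤ r) :
    gaussE (q * φ) = gaussE q := by
  have h : ∀ k ≤ r, gaussE (X ^ k * φ) = gaussE (X ^ k) := by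
    intro k hk
    rcases Nat.eq_zero_or_pos k with rfl | hk0
    · rw [pow_zero, one_mul, ← C_1, gaussE_C, gaussE_apply, hφ.integral_eq_one]
    · simpa only [gaussE_apply, eval_mul, eval_pow, eval_X] using hmom k hk0 hk
  rw [q.as_sum_range_C_mul_X_pow, Finset.sum_mul, map_sum, map_sum]
  refine Finset.sum_congr rfl fun k hk => ?_
  rw [mul_assoc, gaussE_C_mul, gaussE_C_mul, h k (by have := Finset.mem_range.1 hk; omega)]

theorem hermiteCoeff_of_matchesMoments {r : ℕ} {φ : ℝ[X]} (hφ : IsDensity φ)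
    (hmom : MatchesMoments r φ) {k : ℕ} (hk : k ≤ r) :
    hermiteCoeff (fun x => φ.eval x) k = if k = 0 then 1 else 0 := by
  have h : (hermiteR k).natDegree = k := hermiteSeq.natDegree_eq k
  rw [hermiteCoeff_eval, gaussE_mul_of_matchesMoments hφ hmom (h.trans_le hk),
    ← mul_one (hermiteR k), ← hermiteR_zero, gaussE_hermiteR_mul_hermiteR]
  rcases eq_or_ne k 0 with rfl | hk0
  · simp
  · rw [if_neg hk0.symm, if_neg hk0, zero_div]

theorem hermiteCoeff_eval_of_natDegree_lt {φ : ℝ[X]} {k : ℕ} (hk : φ.natDegree < k) :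
    hermiteCoeff (fun x => φ.eval x) k = 0 := by
  rw [hermiteCoeff_eval, gaussE_hermiteR_mul, iterate_derivative_eq_zero hk, map_zero, zero_div]

theorem gammaCoeff_eq (K : ℕ) (φ : ℝ[X]) (k : ℕ) :
    gammaCoeff K φ k = |hermiteCoeff (fun x => φ.eval x) k| / √(k.factorial : ℝ) *
      √(1 + (φ.natDegree : ℝ) / K) ^ k := by
  rw [gammaCoeff, Real.rpow_div_two_eq_sqrt _ (by positivity), Real.rpow_natCast]
  ring

/-- The `1` in `growth` is `γ_0`; the other indices outside `[K, N]` contribute nothing, by moment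
matching below and by degree above. -/
theorem sum_gammaCoeff_le_growth {r : ℕ} {φ : ℝ[X]} (hφ : IsDensity φ)
    (hmom : MatchesMoments r φ) {u : ℝ} (hu : 0 ≤ u) (s : Finset ℕ) :
    ∑ k ∈ s, gammaCoeff (r + 1) φ k * u ^ k ≤ growth (r + 1) φ u := by
  have h0 : gammaCoeff (r + 1) φ 0 = 1 := by
    rw [gammaCoeff_eq, hermiteCoeff_of_matchesMoments hφ hmom (Nat.zero_le r)]
    simp
  have h1 : growth (r + 1) φ u =
      ∑ k ∈ insert 0 (Finset.Icc (r + 1) φ.natDegree), gammaCoeff (r + 1) φ k * u ^ k := by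
    rw [Finset.sum_insert (by simp), h0, growth]
    simp
  rw [h1, ← Finset.sum_filter_ne_zero]
  refine Finset.sum_le_sum_of_subset_of_nonneg (fun k hk => ?_)
    fun k _ _ => mul_nonneg (gammaCoeff_nonneg _ _ _) (pow_nonneg hu k)
  have hne : hermiteCoeff (fun x => φ.eval x) k ≠ 0 := fun h => (Finset.mem_filter.1 hk).2 (by
    rw [gammaCoeff_eq, h]; simp)
  rw [Finset.mem_insert, Finset.mem_Icc]
  by_contra! hc
  rcases le_or_gt k r with hkr | hkr
  · exact hne (by rw [hermiteCoeff_of_matchesMoments hφ hmom hkr, if_neg hc.1])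
  · exact hne (hermiteCoeff_eval_of_natDegree_lt (hc.2 hkr))

/-! ### Bounds on single matrix entries -/

theorem sqrt_choose_mul_pow_le {a : ℝ} (ha0 : 0 < a) (n k : ℕ) :
    √(n.choose k : ℝ) * √(1 - a ^ 2) ^ k ≤
      √(n * (-2 * Real.log a)) ^ k / √(k.factorial : ℝ) := by
  have hb : 1 - a ^ 2 ≤ -2 * Real.log a := by
    have := Real.log_le_sub_one_of_pos (sq_pos_of_pos ha0)
    rw [Real.log_pow] at this
    push_cast at this
    linarith
  have h1 : √(n.choose k : ℝ) ≤ √n ^ k / √(k.factorial : ℝ) := by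
    refine Real.sqrt_le_iff.2 ⟨by positivity, ?_⟩
    rw [div_pow, ← pow_mul, mul_comm k, pow_mul, Real.sq_sqrt (Nat.cast_nonneg n),
      Real.sq_sqrt (by positivity)]
    exact Nat.choose_le_pow_div k n
  rw [Real.sqrt_mul (Nat.cast_nonneg n), mul_pow, mul_div_right_comm]
  gcongr

/-- For `m ≥ K` and `k ≤ N` one has `m + k ≤ (1 + N/K) m`: the row index is traded for the column
index at the cost of the factor built into `γ_k`. -/
theorem entry_le_col {K : ℕ} (hK : 0 < K) (φ : ℝ[X]) {a : ℝ} (ha0 : 0 < a) (ha1 : a ≤ 1)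
    {m : ℕ} (hm : K ≤ m) (k : ℕ) :
    √((m + k).choose k : ℝ) * a ^ m * √(1 - a ^ 2) ^ k *
        |hermiteCoeff (fun x => φ.eval x) k| ≤
      a ^ m * (gammaCoeff K φ k * √(m * (-2 * Real.log a)) ^ k) := by
  rcases lt_or_ge φ.natDegree k with hk | hk
  · rw [gammaCoeff_eq, hermiteCoeff_eval_of_natDegree_lt hk]
    simp
  have ht : 0 ≤ -2 * Real.log a := by linarith [Real.log_nonpos ha0.le ha1]
  have hK' : (0 : ℝ) < K := by exact_mod_cast hK
  have hm' : (K : ℝ) ≤ m := by exact_mod_cast hm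
  have hk' : (k : ℝ) ≤ φ.natDegree := by exact_mod_cast hk
  have h1 : ((m + k : ℕ) : ℝ) ≤ (1 + (φ.natDegree : ℝ) / K) * m := by
    have : (φ.natDegree : ℝ) ≤ φ.natDegree / K * m := by
      rw [div_mul_eq_mul_div, le_div_iff₀ hK']
      exact mul_le_mul_of_nonneg_left hm' (Nat.cast_nonneg _)
    push_cast
    linarith
  have h2 : √((m + k : ℕ) * (-2 * Real.log a)) ≤
      √(1 + (φ.natDegree : ℝ) / K) * √(m * (-2 * Real.log a)) := by
    rw [← Real.sqrt_mul (by positivity), ← mul_assoc (1 + _)]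
    exact Real.sqrt_le_sqrt (mul_le_mul_of_nonneg_right h1 ht)
  have h3 := (sqrt_choose_mul_pow_le ha0 (m + k) k).trans
    (div_le_div_of_nonneg_right (pow_le_pow_left₀ (Real.sqrt_nonneg _) h2 k)
      (Real.sqrt_nonneg _))
  have h4 := mul_le_mul_of_nonneg_left h3
    (by positivity : 0 ≤ a ^ m * |hermiteCoeff (fun x => φ.eval x) k|)
  rw [mul_pow] at h4
  rw [gammaCoeff_eq]
  refine le_trans (le_of_eq ?_) (h4.trans (le_of_eq ?_)) <;> ring

/-- Here the factor in `γ_k` pays for replacing `a^m` by `a^(m+k)`, since `a⁻¹ ≤ √(1 + N/K)`. -/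
theorem entry_le_row {K : ℕ} (φ : ℝ[X]) {a : ℝ} (ha0 : 0 < a)
    (ha : φ ≠ 1 → 1 ≤ a * √(1 + (φ.natDegree : ℝ) / K)) (m k : ℕ) :
    √((m + k).choose k : ℝ) * a ^ m * √(1 - a ^ 2) ^ k *
        |hermiteCoeff (fun x => φ.eval x) k| ≤
      a ^ (m + k) * (gammaCoeff K φ k * √((m + k : ℕ) * (-2 * Real.log a)) ^ k) := by
  have h1 : |hermiteCoeff (fun x => φ.eval x) k| ≤
      |hermiteCoeff (fun x => φ.eval x) k| * (a * √(1 + (φ.natDegree : ℝ) / K)) ^ k := by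
    rcases Nat.eq_zero_or_pos k with rfl | hk
    · simp
    -- For `φ = 1` there is no such lower bound on `a`, but the coefficients with `k ≥ 1` vanish.
    · by_cases hφ : φ = 1
      · rw [hermiteCoeff_eval_of_natDegree_lt (by rw [hφ, natDegree_one]; exact hk)]
        simp
      · exact le_mul_of_one_le_right (abs_nonneg _) (one_le_pow₀ (ha hφ))
  have h2 := sqrt_choose_mul_pow_le ha0 (m + k) k
  have h3 := mul_le_mul_of_nonneg_left (mul_le_mul h2 h1 (abs_nonneg _) (by positivity))
    (pow_nonneg ha0.le m)
  rw [mul_pow] at h3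
  rw [gammaCoeff_eq, pow_add]
  refine le_trans (le_of_eq ?_) (h3.trans (le_of_eq ?_)) <;> ring

theorem pow_mul_growth_le {r : ℕ} (hr : 1 ≤ r) {φ : ℝ[X]} (hH : HypH (r + 1) φ) {a : ℝ}
    (ha0 : 0 < a) (ha1 : a ≤ 1) {n : ℕ} (hn : r + 1 ≤ n) :
    a ^ n * growth (r + 1) φ √(n * (-2 * Real.log a)) ≤ a ^ (r + 1) * (1 + dPhi r φ a) := by
  have ht : 0 ≤ -2 * Real.log a := by linarith [Real.log_nonpos ha0.le ha1]
  have hexp : ∀ n : ℕ, Real.exp (-√(n * (-2 * Real.log a)) ^ 2 / 2) = a ^ n := by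
    intro n
    rw [Real.sq_sqrt (by positivity)]
    have : -(n * (-2 * Real.log a)) / 2 = n * Real.log a := by ring
    rw [this, Real.exp_nat_mul, Real.exp_log ha0]
  -- Compare the points `√(n t)` and `√(K t)`, where `t = -2 log a`.
  have h1 := antitoneOn_exp_mul_growth (by omega : 2 ≤ r + 1) hH
    (Set.mem_Ici.2 (Real.sqrt_nonneg (((r + 1 : ℕ) : ℝ) * (-2 * Real.log a))))
    (Set.mem_Ici.2 (Real.sqrt_nonneg ((n : ℝ) * (-2 * Real.log a))))
    (Real.sqrt_le_sqrt (mul_le_mul_of_nonneg_right (by exact_mod_cast hn) ht))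
  simp only [hexp] at h1
  refine h1.trans (mul_le_mul_of_nonneg_left ?_ (by positivity))
  refine add_le_add_right (Finset.sum_le_sum fun k _ => ?_) 1
  rw [gammaCoeff_eq, mul_assoc]
  refine mul_le_mul_of_nonneg_left ?_ (by positivity)
  have e : -2 * ((r : ℝ) + 1 + φ.natDegree) * (1 + (φ.natDegree : ℝ) / ((r : ℝ) + 1)) *
      Real.log a = (1 + (φ.natDegree : ℝ) / ((r : ℝ) + 1)) *
        (((r : ℝ) + 1 + φ.natDegree) * (-2 * Real.log a)) := by ring
  rw [e, Real.rpow_div_two_eq_sqrt _ (by positivity), Real.rpow_natCast,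
    Real.sqrt_mul (x := 1 + (φ.natDegree : ℝ) / ((r : ℝ) + 1)) (by positivity), mul_pow,
    Nat.cast_succ]
  refine mul_le_mul_of_nonneg_left (pow_le_pow_left₀ (Real.sqrt_nonneg _)
    (Real.sqrt_le_sqrt (mul_le_mul_of_nonneg_right ?_ ht)) k) (by positivity)
  -- Slack: `d_φ` carries `K + N` where `K` would suffice.
  exact le_add_of_nonneg_right (Nat.cast_nonneg _)

theorem one_le_mul_sqrt_of_aPhi_lt {r : ℕ} {φ : ℝ[X]} {a : ℝ} (ha : aPhi r φ < a) (hφ : φ ≠ 1) :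
    1 ≤ a * √(1 + (φ.natDegree : ℝ) / (r + 1 : ℕ)) := by
  rw [aPhi, if_neg hφ] at ha
  push_cast
  set A := 1 + (φ.natDegree : ℝ) / ((r : ℝ) + 1)
  have hA : 1 ≤ A := le_add_of_nonneg_right (by positivity)
  calc (1 : ℝ) ≤ A ^ ((1 : ℝ) / 4) := Real.one_le_rpow hA (by norm_num)
    _ = A ^ (-(1 / 4) : ℝ) * √A := by
      rw [Real.sqrt_eq_rpow, ← Real.rpow_add (by linarith)]
      norm_num
    _ ≤ a * √A := mul_le_mul_of_nonneg_right ha.le (Real.sqrt_nonneg _)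

theorem aPhi_nonneg (r : ℕ) (φ : ℝ[X]) : 0 ≤ aPhi r φ := by
  unfold aPhi
  split_ifs
  · exact le_rfl
  · positivity

/-! ### Row and column sums of the adjoint matrix -/

/-- The matrix, in the Hermite basis, of the restriction of `Q*_{a,φ}` to the functions
whose Hermite coefficients of order less than `K` vanish. -/
def adjMatrix (K : ℕ) (φ : ℝ[X]) (a : ℝ) (n m : ℕ) : ℝ :=
  if m ≤ n ∧ K ≤ m then √(n.choose (n - m) : ℝ) * a ^ m * √(1 - a ^ 2) ^ (n - m) *
    hermiteCoeff (fun x => φ.eval x) (n - m) else 0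

theorem abs_adjMatrix_of_le {K : ℕ} (φ : ℝ[X]) {a : ℝ} (ha0 : 0 < a) {m : ℕ}
    (hm : K ≤ m) (k : ℕ) :
    |adjMatrix K φ a (m + k) m| = √((m + k).choose k : ℝ) * a ^ m * √(1 - a ^ 2) ^ k *
        |hermiteCoeff (fun x => φ.eval x) k| := by
  rw [adjMatrix, if_pos ⟨Nat.le_add_right m k, hm⟩, Nat.add_sub_cancel_left, abs_mul,
    abs_of_nonneg (by positivity)]

theorem dPhi_nonneg (r : ℕ) (φ : ℝ[X]) {a : ℝ} (ha0 : 0 < a) (ha1 : a ≤ 1) : 0 ≤ dPhi r φ a := by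
  refine Finset.sum_nonneg fun k _ => mul_nonneg (by positivity) (Real.rpow_nonneg ?_ _)
  refine mul_nonneg_of_nonpos_of_nonpos ?_ (Real.log_nonpos ha0.le ha1)
  have : 0 ≤ ((r : ℝ) + 1 + φ.natDegree) * (1 + (φ.natDegree : ℝ) / ((r : ℝ) + 1)) := by
    positivity
  linarith

section

variable {r : ℕ} {φ : ℝ[X]} {a : ℝ}

theorem adjMatrix_row_le (hr : 1 ≤ r) (hφ : IsDensity φ) (hmom : MatchesMoments r φ)
    (hH : HypH (r + 1) φ) (ha : a ∈ Set.Ioo (aPhi r φ) 1) (L : ℕ) {n : ℕ} (hn : n < L) :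
    ∑ m ∈ Finset.range L, |adjMatrix (r + 1) φ a n m| ≤ a ^ (r + 1) * (1 + dPhi r φ a) := by
  have ha0 : 0 < a := (aPhi_nonneg r φ).trans_lt ha.1
  have hd := dPhi_nonneg r φ ha0 ha.2.le
  rcases lt_or_ge n (r + 1) with hnr | hnr
  · rw [Finset.sum_eq_zero fun m _ => by
      rw [adjMatrix, if_neg (by omega), abs_zero]]
    positivity
  refine le_trans ?_ (pow_mul_growth_le hr hH ha0 ha.2.le hnr)
  refine le_trans ?_ (mul_le_mul_of_nonneg_left (sum_gammaCoeff_le_growth hφ hmom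
    (Real.sqrt_nonneg _) (Finset.range (n + 1))) (by positivity))
  rw [Finset.mul_sum, ← Finset.sum_flip, ← Finset.sum_subset
    (Finset.range_subset_range.2 hn : Finset.range (n + 1) ⊆ Finset.range L)
    (fun m _ hm => by
      rw [adjMatrix, if_neg (by rw [Finset.mem_range] at hm; omega), abs_zero])]
  refine Finset.sum_le_sum fun m hm => ?_
  have hmn : m ≤ n := Nat.lt_succ_iff.1 (Finset.mem_range.1 hm)
  obtain ⟨k, rfl⟩ := Nat.exists_eq_add_of_le hmn
  rw [Nat.add_sub_cancel_left]
  rcases lt_or_ge m (r + 1) with hmr | hmr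
  · rw [adjMatrix, if_neg (by omega), abs_zero]
    exact mul_nonneg (by positivity) (mul_nonneg (gammaCoeff_nonneg _ _ _) (by positivity))
  · rw [abs_adjMatrix_of_le φ ha0 hmr]
    exact entry_le_row φ ha0 (one_le_mul_sqrt_of_aPhi_lt ha.1) m k

theorem adjMatrix_col_le (hr : 1 ≤ r) (hφ : IsDensity φ) (hmom : MatchesMoments r φ)
    (hH : HypH (r + 1) φ) (ha : a ∈ Set.Ioo (aPhi r φ) 1) (L : ℕ) {m : ℕ} (hm : m < L) :
    ∑ n ∈ Finset.range L, |adjMatrix (r + 1) φ a n m| ≤ a ^ (r + 1) * (1 + dPhi r φ a) := by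
  have ha0 : 0 < a := (aPhi_nonneg r φ).trans_lt ha.1
  have hd := dPhi_nonneg r φ ha0 ha.2.le
  rcases lt_or_ge m (r + 1) with hmr | hmr
  · rw [Finset.sum_eq_zero fun n _ => by
      rw [adjMatrix, if_neg (by omega), abs_zero]]
    positivity
  refine le_trans ?_ (pow_mul_growth_le hr hH ha0 ha.2.le hmr)
  refine le_trans ?_ (mul_le_mul_of_nonneg_left (sum_gammaCoeff_le_growth hφ hmom
    (Real.sqrt_nonneg _) (Finset.range (L - m))) (by positivity))
  rw [Finset.range_eq_Ico, ← Finset.sum_Ico_consecutive _ (Nat.zero_le m) hm.le,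
    Finset.sum_eq_zero (s := Finset.Ico 0 m) (fun n hn => by
      rw [adjMatrix, if_neg (by rw [Finset.mem_Ico] at hn; omega), abs_zero]),
    zero_add, Finset.sum_Ico_eq_sum_range, Finset.mul_sum]
  refine Finset.sum_le_sum fun k _ => ?_
  rw [abs_adjMatrix_of_le φ ha0 hmr]
  exact entry_le_col (Nat.succ_pos r) φ ha0 ha.2.le hmr k

end

/-- Triangularity makes truncation to indices below `L` exact, so the finite Schur test suffices. -/
theorem hermiteCoeff_transOpAdj_eq_sum {K : ℕ} {a : ℝ} (ha : a ∈ Set.Icc (0 : ℝ) 1) (φ : ℝ[X])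
    (g : L2) (hg : ∀ k < K, hermiteCoeff g k = 0) {n L : ℕ} (hn : n < L) :
    hermiteCoeff (transOpAdj a ha (fun y => φ.eval y) (memLp_eval φ) g) n =
      ∑ m ∈ Finset.range L, adjMatrix K φ a n m * hermiteCoeff g m := by
  rw [hermiteCoeff_transOpAdj, ← Finset.sum_flip, ← Finset.sum_subset
    (Finset.range_subset_range.2 hn : Finset.range (n + 1) ⊆ Finset.range L)
    (fun m _ hm => by
      rw [adjMatrix, if_neg (by rw [Finset.mem_range] at hm; omega), zero_mul])]
  refine Finset.sum_congr rfl fun m hm => ?_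
  have hmn : m ≤ n := Nat.lt_succ_iff.1 (Finset.mem_range.1 hm)
  rw [Nat.sub_sub_self hmn]
  rcases lt_or_ge m K with hmK | hmK
  · rw [hg m hmK, mul_zero, mul_zero]
  · rw [adjMatrix, if_pos ⟨hmn, hmK⟩]

end BaryConv
end

theorem mainTheorem3 (r : ℕ) (hr : 1 ≤ r) (φ : Polynomial ℝ)
    (hφ : BaryConv.IsDensity φ) (hmom : BaryConv.MatchesMoments r φ)
    (hH : BaryConv.HypH (r + 1) φ)
    (g : BaryConv.L2) (hg : ∀ k : ℕ, k < r + 1 → BaryConv.hermiteCoeff g k = 0)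
    (a : ℝ) (ha : a ∈ Set.Ioo (BaryConv.aPhi r φ) 1) :
    (∫ x, (BaryConv.transOpAdj a (BaryConv.mem_Icc_of_mem_Ioo_aPhi ha)
          (fun y => φ.eval y) (BaryConv.memLp_eval φ) g x) ^ 2 ∂BaryConv.gauss
        ≤ a ^ (r + 1) * (1 + BaryConv.dPhi r φ a) ^ 2 * ∫ x, (g x) ^ 2 ∂BaryConv.gauss) ∧
    (∫ x, (BaryConv.transOpAdj a (BaryConv.mem_Icc_of_mem_Ioo_aPhi ha)
          (fun y => φ.eval y) (BaryConv.memLp_eval φ) g x) ^ 2 ∂BaryConv.gauss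
        ≤ a ^ (2 * (r + 1)) * (1 + BaryConv.dPhi r φ a) ^ 2 *
          ∫ x, (g x) ^ 2 ∂BaryConv.gauss) := by
  have ha0 : 0 ≤ a := (BaryConv.mem_Icc_of_mem_Ioo_aPhi ha).1
  have key : ∫ x, (BaryConv.transOpAdj a (BaryConv.mem_Icc_of_mem_Ioo_aPhi ha)
          (fun y => φ.eval y) (BaryConv.memLp_eval φ) g x) ^ 2 ∂BaryConv.gauss
        ≤ a ^ (2 * (r + 1)) * (1 + BaryConv.dPhi r φ a) ^ 2 *
          ∫ x, (g x) ^ 2 ∂BaryConv.gauss := by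
    rw [mul_comm 2 (r + 1), pow_mul, ← mul_pow]
    -- Bound every partial Parseval sum of `Q* g` uniformly in `L`.
    refine le_of_tendsto (BaryConv.hasSum_hermiteCoeff_sq _).tendsto_sum_nat
      (Filter.Eventually.of_forall fun L => ?_)
    have hsum := (BaryConv.hasSum_hermiteCoeff_sq g).summable.sum_le_tsum (Finset.range L)
      fun _ _ => sq_nonneg _
    rw [(BaryConv.hasSum_hermiteCoeff_sq g).tsum_eq] at hsum
    refine le_trans ?_ (mul_le_mul_of_nonneg_left hsum (sq_nonneg _))
    rw [Finset.sum_congr rfl fun n hn => by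
      rw [BaryConv.hermiteCoeff_transOpAdj_eq_sum _ φ g hg (Finset.mem_range.1 hn)]]
    exact BaryConv.sum_sq_sum_mul_le _ _ _
      (fun n hn => BaryConv.adjMatrix_row_le hr hφ hmom hH ha L (Finset.mem_range.1 hn))
      (fun m hm => BaryConv.adjMatrix_col_le hr hφ hmom hH ha L (Finset.mem_range.1 hm))
  refine ⟨key.trans ?_, key⟩
  have hpow : a ^ (2 * (r + 1)) ≤ a ^ (r + 1) := pow_le_pow_of_le_one ha0 ha.2.le (by omega)
  have hint : 0 ≤ ∫ x, (g x) ^ 2 ∂BaryConv.gauss := integral_nonneg fun x => sq_nonneg _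
  gcongr
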